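/- Let $\mathfrak{A}$ be a unital C*-algebra. A state of $\mathfrak{A}$ is a linear functional $\psi$ with $\psi(A^*A)\ge 0$ for all $A\in\mathfrak{A}$ and $\psi(1)=1$; a pure state is an extreme point of the convex set of states. For a unital $*$-representation $\pi$ of $\mathfrak{A}$ on a complex Hilbert space $\mathcal{H}$ and a state $\psi$, put $S(\pi,\psi)=\{x\in\mathcal{H} : \psi(A)=\langle x,\pi(A)x\rangle \text{ for all } A\in\mathfrak{A}\}$. For states $\psi,\phi$ let $F_\pi(\psi,\phi)=\sup\{|\langle x,y\rangle| : x\in S(\pi,\psi),\ y\in S(\pi,\phi)\}$ if both sets are nonempty and $F_\pi(\psi,\phi)=0$ otherwise, and let the fidelity be $F(\psi,\phi)=\sup_\pi F_\pi(\psi,\phi)$, the supremum being over all such representations $\pi$ of $\mathfrak{A}$. Then the following conditions are equivalent. \begin{enumerate} \item $\mathfrak{A}$ is not abelian. \item There are pure states $\psi$ and $\phi$ of $\mathfrak{A}$ such that $0<F(\psi,\phi)<1$. \item For every real number $\alpha$ with $0\le\alpha\le 1$ there are pure states $\psi$ and $\phi$ of $\mathfrak{A}$ such that $F(\psi,\phi)=\alpha$.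 \end{enumerate} -/

import Mathlib

open scoped ComplexOrder

universe u

namespace CStarFidelity

/-- The state space of a unital C*-algebra `A`: the linear functionals `ψ` on `A` that are positive
(`ψ (a* a) ≥ 0` for all `a`) and normalised (`ψ 1 = 1`). -/
def stateSpace (A : Type u) [CStarAlgebra A] : Set (A →L[ℂ] ℂ) :=
  {ψ | (∀ a : A, 0 ≤ ψ (star a * a)) ∧ ψ 1 = 1}

/-- The pure states of `A`: the extreme points of the (convex) state space. -/
def pureStates (A : Type u) [CStarAlgebra A] : Set (A →L[ℂ] ℂ) :=
  Set.extremePoints ℝ (stateSpace A)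

section

variable {A : Type u} [CStarAlgebra A]

/-- The set `S(π, ψ)` of all vectors `x` with `ψ a = ⟪x, π a x⟫` for all `a`, for a (unital)
*-representation `π` of `A` on a Hilbert space `H`. The inner product is linear in its second
argument. -/
def implementingVectors {H : Type u} [NormedAddCommGroup H] [InnerProductSpace ℂ H]
    [CompleteSpace H] (π : A →⋆ₐ[ℂ] (H →L[ℂ] H)) (ψ : A →L[ℂ] ℂ) : Set H :=
  {x | ∀ a : A, ψ a = inner ℂ x (π a x)}

/-- The values `|⟪x, y⟫|` with `x ∈ S(π, ψ)` and `y ∈ S(π, φ)`. -/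
def overlaps {H : Type u} [NormedAddCommGroup H] [InnerProductSpace ℂ H]
    [CompleteSpace H] (π : A →⋆ₐ[ℂ] (H →L[ℂ] H)) (ψ φ : A →L[ℂ] ℂ) : Set ℝ :=
  {r | ∃ x ∈ implementingVectors π ψ, ∃ y ∈ implementingVectors π φ, r = ‖inner ℂ x y‖}

/-- The fidelity `F_π(ψ, φ)` relative to a representation `π`: the supremum of `|⟪x, y⟫|` over
`x ∈ S(π, ψ)` and `y ∈ S(π, φ)`, and `0` if one of these sets is empty (the supremum in `ℝ` of the
empty set is `0`). -/
noncomputable def repFidelity {H : Type u} [NormedAddCommGroup H] [InnerProductSpace ℂ H]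
    [CompleteSpace H] (π : A →⋆ₐ[ℂ] (H →L[ℂ] H)) (ψ φ : A →L[ℂ] ℂ) : ℝ :=
  sSup (overlaps π ψ φ)

/-- The values `F_π(ψ, φ)` over all representations `π` of `A` on Hilbert spaces. Hilbert spaces in
the universe of `A` suffice: restricting a representation to the closed invariant subspace
generated by two vectors changes nothing, and that subspace has a dense subset that is a
quotient of `A × A`. -/
def repFidelities (ψ φ : A →L[ℂ] ℂ) : Set ℝ :=
  {r | ∃ (H : Type u) (_ : NormedAddCommGroup H) (_ : InnerProductSpace ℂ H)
    (_ : CompleteSpace H) (π : A →⋆ₐ[ℂ] (H →L[ℂ] H)), r = repFidelity π ψ φ}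

/-- The fidelity `F(ψ, φ) = sup_π F_π(ψ, φ)`. -/
noncomputable def fidelity (ψ φ : A →L[ℂ] ℂ) : ℝ :=
  sSup (repFidelities ψ φ)

/-! The two suprema are taken over sets of reals that are bounded by `1`. -/

theorem norm_eq_one_of_mem {H : Type u} [NormedAddCommGroup H] [InnerProductSpace ℂ H]
    [CompleteSpace H] {π : A →⋆ₐ[ℂ] (H →L[ℂ] H)} {ψ : A →L[ℂ] ℂ} (hψ : ψ ∈ stateSpace A) {x : H}
    (hx : x ∈ implementingVectors π ψ) : ‖x‖ = 1 := by
  have h := hx 1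
  rw [hψ.2, map_one, one_apply_eq_self, inner_self_eq_norm_sq_to_K] at h
  have h2 : ‖x‖ ^ 2 = 1 := by
    have h3 : ((‖x‖ ^ 2 : ℝ) : ℂ) = ((1 : ℝ) : ℂ) := by push_cast; exact h.symm
    exact Complex.ofReal_injective h3
  nlinarith [norm_nonneg x]

theorem le_one_of_mem_overlaps {H : Type u} [NormedAddCommGroup H] [InnerProductSpace ℂ H]
    [CompleteSpace H] {π : A →⋆ₐ[ℂ] (H →L[ℂ] H)} {ψ φ : A →L[ℂ] ℂ} (hψ : ψ ∈ stateSpace A)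
    (hφ : φ ∈ stateSpace A) {r : ℝ} (hr : r ∈ overlaps π ψ φ) : r ≤ 1 := by
  obtain ⟨x, hx, y, hy, rfl⟩ := hr
  have h := norm_inner_le_norm (𝕜 := ℂ) x y
  rwa [norm_eq_one_of_mem hψ hx, norm_eq_one_of_mem hφ hy, one_mul] at h

theorem bddAbove_overlaps {H : Type u} [NormedAddCommGroup H] [InnerProductSpace ℂ H]
    [CompleteSpace H] {π : A →⋆ₐ[ℂ] (H →L[ℂ] H)} {ψ φ : A →L[ℂ] ℂ} (hψ : ψ ∈ stateSpace A)
    (hφ : φ ∈ stateSpace A) : BddAbove (overlaps π ψ φ) :=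
  ⟨1, fun _ hr => le_one_of_mem_overlaps hψ hφ hr⟩

theorem bddAbove_repFidelities {ψ φ : A →L[ℂ] ℂ} (hψ : ψ ∈ stateSpace A)
    (hφ : φ ∈ stateSpace A) : BddAbove (repFidelities ψ φ) := by
  refine ⟨1, ?_⟩
  rintro r ⟨H, _, _, _, π, rfl⟩
  exact Real.sSup_le (fun _ hr => le_one_of_mem_overlaps hψ hφ hr) zero_le_one

end

end CStarFidelity

/-! Everything rests on one computation, `HasTrivialCommutant.fidelity_eq`: for unit vectors x, y of
an irreducible representation, the fidelity of their vector states is |⟨x, y⟩|. Implementing vectors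
x', y' in any other representation are images Ux, Vy under contractive intertwiners; U*V lies in the
commutant, hence is a scalar c with |c| ≤ 1, and ⟨x', y'⟩ = c⟨x, y⟩.

Purity and irreducibility match: the GNS representation of a pure state is irreducible, and unit
vectors of an irreducible representation give pure states. If ab ≠ ba, Krein-Milman yields a pure
state not vanishing on c*c for c = ab - ba. Its GNS space has dimension at least two, so unit
vectors with any overlap in [0, 1] exist.

If the algebra is commutative, pure states are multiplicative and implementing vectors are joint
eigenvectors. Those of distinct pure states are orthogonal, so the fidelity takes only the values 0
and 1. -/

namespace CStarFidelity

variable {A : Type u} [CStarAlgebra A]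

/-- The orbit map `a ↦ π a x` of a vector `x` under a representation `π`. -/
noncomputable def orbitMap {H : Type u} [NormedAddCommGroup H] [InnerProductSpace ℂ H] [CompleteSpace H]
    (π : A →⋆ₐ[ℂ] (H →L[ℂ] H)) (x : H) : A →ₗ[ℂ] H where
  toFun a := π a x
  map_add' a b := by simp
  map_smul' c a := by simp

/-- The commutant of the representation `π` consists of scalars, that is, `π` is irreducible. -/
def HasTrivialCommutant {H : Type u} [NormedAddCommGroup H] [InnerProductSpace ℂ H]
    [CompleteSpace H] (π : A →⋆ₐ[ℂ] (H →L[ℂ] H)) : Prop :=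
  ∀ T : H →L[ℂ] H, (∀ a v, T (π a v) = π a (T v)) → ∃ c : ℂ, ∀ v, T v = c • v

/-! ### The GNS construction -/

section GNS

attribute [local instance] CStarAlgebra.spectralOrder CStarAlgebra.spectralOrderedRing

theorem exists_cyclic_representation {ψ : A →L[ℂ] ℂ} (hψ : ∀ a, 0 ≤ ψ (star a * a)) :
    ∃ (H : Type u) (_ : NormedAddCommGroup H) (_ : InnerProductSpace ℂ H) (_ : CompleteSpace H)
      (π : A →⋆ₐ[ℂ] (H →L[ℂ] H)) (x : H), x ∈ implementingVectors π ψ ∧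
        DenseRange (orbitMap π x) := by
  have hpos : ∀ a : A, 0 ≤ a → 0 ≤ (ψ : A →ₗ[ℂ] ℂ) a := by
    intro a ha
    obtain ⟨b, rfl⟩ := CStarAlgebra.nonneg_iff_eq_star_mul_self.mp ha
    exact hψ b
  let f : A →ₚ[ℂ] ℂ := PositiveLinearMap.mk₀ (ψ : A →ₗ[ℂ] ℂ) hpos
  have hf : ∀ a, f a = ψ a := fun a => rfl
  have hact : ∀ a, f.gnsStarAlgHom a ((f.toPreGNS 1 : f.PreGNS) : f.GNS)
      = ((f.toPreGNS a : f.PreGNS) : f.GNS) := by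
    intro a
    exact (f.gnsNonUnitalStarAlgHom_apply_coe (a := a)).trans (by simp)
  refine ⟨f.GNS, inferInstance, inferInstance, inferInstance, f.gnsStarAlgHom,
    ((f.toPreGNS 1 : f.PreGNS) : f.GNS), ?_, ?_⟩
  · intro a
    rw [hact, UniformSpace.Completion.inner_coe, PositiveLinearMap.preGNS_inner_def]
    simp [hf]
  · have h := (UniformSpace.Completion.denseRange_coe (α := f.PreGNS)).comp
      f.toPreGNS.surjective.denseRange (UniformSpace.Completion.continuous_coe _)
    convert h using 1
    ext a
    exact hact a

end GNS

theorem inner_self_eq_ofReal {H : Type u} [NormedAddCommGroup H] [InnerProductSpace ℂ H] (v : H) :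
    inner ℂ v v = ((‖v‖ ^ 2 : ℝ) : ℂ) := by
  rw [inner_self_eq_norm_sq_to_K]; push_cast; rfl

/-! ### Vector functionals, intertwiners and cyclic vectors -/

section Representation

variable {H : Type u} [NormedAddCommGroup H] [InnerProductSpace ℂ H] [CompleteSpace H]
  {π : A →⋆ₐ[ℂ] (H →L[ℂ] H)}
  {K : Type u} [NormedAddCommGroup K] [InnerProductSpace ℂ K] [CompleteSpace K]
  {ρ : A →⋆ₐ[ℂ] (K →L[ℂ] K)}

@[simp]
theorem orbitMap_apply (x : H) (a : A) : orbitMap π x a = π a x := rfl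

theorem map_mul_apply_eq (π : A →⋆ₐ[ℂ] (H →L[ℂ] H)) (a b : A) (v : H) :
    π (a * b) v = π a (π b v) := by
  rw [map_mul]; rfl

theorem inner_map_right (π : A →⋆ₐ[ℂ] (H →L[ℂ] H)) (a : A) (v w : H) :
    inner ℂ v (π a w) = inner ℂ (π (star a) v) w := by
  rw [map_star, ContinuousLinearMap.star_eq_adjoint, ContinuousLinearMap.adjoint_inner_left]

theorem inner_map_map (π : A →⋆ₐ[ℂ] (H →L[ℂ] H)) (a b : A) (v w : H) :
    inner ℂ (π a v) (π b w) = inner ℂ v (π (star a * b) w) := by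
  rw [map_mul_apply_eq, inner_map_right π (star a), star_star]

/-- The functional `a ↦ ⟪x, π a y⟫`. -/
noncomputable def coefficient (π : A →⋆ₐ[ℂ] (H →L[ℂ] H)) (x y : H) : A →L[ℂ] ℂ :=
  LinearMap.mkContinuous ((innerSL ℂ x : H →ₗ[ℂ] ℂ) ∘ₗ orbitMap π y) (‖x‖ * ‖y‖) fun a => by
    calc ‖inner ℂ x (π a y)‖ ≤ ‖x‖ * (‖π a‖ * ‖y‖) :=
          (norm_inner_le_norm x _).trans (by gcongr; exact (π a).le_opNorm y)
      _ ≤ ‖x‖ * (‖a‖ * ‖y‖) := by gcongr; exact NonUnitalStarAlgHom.norm_apply_le π a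
      _ = ‖x‖ * ‖y‖ * ‖a‖ := by ring

@[simp]
theorem coefficient_apply (π : A →⋆ₐ[ℂ] (H →L[ℂ] H)) (x y : H) (a : A) :
    coefficient π x y a = inner ℂ x (π a y) := rfl

theorem coefficient_self_mem_stateSpace (π : A →⋆ₐ[ℂ] (H →L[ℂ] H)) {x : H} (hx : ‖x‖ = 1) :
    coefficient π x x ∈ stateSpace A := by
  refine ⟨fun a => ?_, ?_⟩
  · rw [coefficient_apply, ← inner_map_map]
    rw [inner_self_eq_ofReal]
    exact_mod_cast sq_nonneg ‖π a x‖
  · rw [coefficient_apply, map_one, one_apply_eq_self, inner_self_eq_ofReal, hx]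
    simp

theorem mem_implementingVectors_coefficient (π : A →⋆ₐ[ℂ] (H →L[ℂ] H)) (x : H) :
    x ∈ implementingVectors π (coefficient π x x) := fun _ => rfl

theorem norm_sq_map_eq {ψ : A →L[ℂ] ℂ} {x : H} (hx : x ∈ implementingVectors π ψ) (a : A) :
    ((‖π a x‖ ^ 2 : ℝ) : ℂ) = ψ (star a * a) := by
  rw [hx, ← inner_map_map, inner_self_eq_ofReal]

/-- If `x` is cyclic for `π` and `‖ρ a y‖ ≤ C ‖π a x‖`, then `π a x ↦ ρ a y` extends to a bounded
intertwining operator. -/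
theorem exists_intertwiner {x : H} (hx : DenseRange (orbitMap π x)) {y : K} {C : ℝ} (hC : 0 ≤ C)
    (h : ∀ a, ‖ρ a y‖ ≤ C * ‖π a x‖) :
    ∃ W : H →L[ℂ] K, ‖W‖ ≤ C ∧ W x = y ∧ ∀ a v, W (π a v) = ρ a (W v) := by
  have hW : ∀ a, (orbitMap ρ y).extendOfNorm (orbitMap π x) (π a x) = ρ a y :=
    fun a => LinearMap.extendOfNorm_eq (f := orbitMap ρ y) hx ⟨C, h⟩ a
  refine ⟨(orbitMap ρ y).extendOfNorm (orbitMap π x),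
    LinearMap.opNorm_extendOfNorm_le hx hC h, by simpa using hW 1, fun a v => ?_⟩
  refine hx.induction_on v (isClosed_eq (by fun_prop) (by fun_prop)) fun b => ?_
  rw [orbitMap_apply, ← map_mul_apply_eq, hW, hW, map_mul_apply_eq]

theorem adjoint_comp_intertwines {L : Type u} [NormedAddCommGroup L] [InnerProductSpace ℂ L]
    [CompleteSpace L] {σ : A →⋆ₐ[ℂ] (L →L[ℂ] L)} {U : H →L[ℂ] K} {V : L →L[ℂ] K}
    (hU : ∀ a v, U (π a v) = ρ a (U v)) (hV : ∀ a v, V (σ a v) = ρ a (V v)) (a : A) (v : L) :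
    U.adjoint (V (σ a v)) = π a (U.adjoint (V v)) := by
  refine ext_inner_left ℂ fun w => ?_
  rw [ContinuousLinearMap.adjoint_inner_right, hV, inner_map_right, inner_map_right, ← hU,
    ContinuousLinearMap.adjoint_inner_right]

/-- The projection onto the closed cyclic subspace of y commutes with π, so it is a scalar; it fixes
y ≠ 0, so it is the identity. -/
theorem HasTrivialCommutant.denseRange_orbitMap (hπ : HasTrivialCommutant π) {y : H}
    (hy : y ≠ 0) : DenseRange (orbitMap π y) := by
  set M : Submodule ℂ H := (LinearMap.range (orbitMap π y)).topologicalClosure with hM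
  have hMc : IsClosed (M : Set H) := Submodule.isClosed_topologicalClosure _
  have : CompleteSpace M := hMc.completeSpace_coe
  have hinv : ∀ a, ∀ v ∈ M, π a v ∈ M := by
    intro a v hv
    refine closure_minimal (s := (LinearMap.range (orbitMap π y) : Set H))
      (t := (π a) ⁻¹' (M : Set H)) ?_ (hMc.preimage (π a).continuous) hv
    rintro _ ⟨b, rfl⟩
    exact Submodule.le_topologicalClosure _ ⟨a * b, by simp⟩
  have hyM : y ∈ M := Submodule.le_topologicalClosure _ ⟨1, by simp⟩
  have hcomm : ∀ a v, M.starProjection (π a v) = π a (M.starProjection v) := by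
    intro a v
    refine Submodule.eq_starProjection_of_mem_of_inner_eq_zero
      (hinv a _ (Submodule.starProjection_apply_mem _ _)) fun w hw => ?_
    rw [← map_sub, ← inner_conj_symm, inner_map_right, inner_conj_symm]
    exact Submodule.starProjection_inner_eq_zero _ _ (hinv _ _ hw)
  obtain ⟨c, hc⟩ := hπ _ hcomm
  have hc1 : c = 1 := by
    have h := hc y
    rw [Submodule.starProjection_eq_self_iff.mpr hyM] at h
    have h2 : (c - 1) • y = 0 := by rw [sub_smul, ← h, one_smul, sub_self]
    exact sub_eq_zero.mp ((smul_eq_zero.mp h2).resolve_right hy)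
  intro v
  have hv : v ∈ M := Submodule.starProjection_eq_self_iff.mp (by rw [hc, hc1, one_smul])
  exact hv

end Representation

/-! ### Purity, irreducibility and the fidelity of vector states -/

section Representation

variable {H : Type u} [NormedAddCommGroup H] [InnerProductSpace ℂ H] [CompleteSpace H]
  {π : A →⋆ₐ[ℂ] (H →L[ℂ] H)}

theorem apply_eq_smul_of_apply_cyclic {x : H} (hx : DenseRange (orbitMap π x)) {T : H →L[ℂ] H}
    (hT : ∀ a v, T (π a v) = π a (T v)) {c : ℂ} (hc : T x = c • x) (v : H) : T v = c • v := by
  refine hx.induction_on v (isClosed_eq (by fun_prop) (by fun_prop)) fun a => ?_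
  rw [orbitMap_apply, hT, hc, map_smul]

theorem eq_of_inner_cyclic {x y z : H} (hx : DenseRange (orbitMap π x))
    (h : ∀ a, inner ℂ y (π a x) = inner ℂ z (π a x)) : y = z := by
  refine ext_inner_right ℂ fun v => ?_
  exact hx.induction_on v (isClosed_eq (by fun_prop) (by fun_prop)) h

/-- A strictly positive operator in the commutant splits a vector state. -/
theorem smul_coefficient_mem_stateSpace {x : H} {P : H →L[ℂ] H}
    (hP : ∀ a v, P (π a v) = π a (P v)) (hpos : ∀ v, 0 ≤ inner ℂ (P v) v) {s : ℝ} (hs : 0 < s)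
    (hsx : inner ℂ (P x) x = (s : ℂ)) : s⁻¹ • coefficient π (P x) x ∈ stateSpace A := by
  refine ⟨fun a => ?_, ?_⟩
  · rw [smul_apply, coefficient_apply, ← inner_map_map, ← hP]
    exact smul_nonneg (by positivity) (hpos _)
  · rw [smul_apply, coefficient_apply, map_one, one_apply_eq_self, hsx]
    rw [Complex.real_smul, ← Complex.ofReal_mul, inv_mul_cancel₀ hs.ne', Complex.ofReal_one]

/-- As P and 1 - P are both at least δ, ψ is a proper convex combination of the normalised
functionals that they induce. Extremality identifies the first with ψ, and cyclicity of x turns this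
into an eigenvector equation. -/
theorem apply_eq_smul_of_bounds {ψ : A →L[ℂ] ℂ} (hψ : ψ ∈ pureStates A) {x : H}
    (hx : x ∈ implementingVectors π ψ) (hc : DenseRange (orbitMap π x)) {P : H →L[ℂ] H}
    (hP : ∀ a v, P (π a v) = π a (P v)) {δ : ℝ} (hδ : 0 < δ) {r : H → ℝ}
    (hr : ∀ v, inner ℂ (P v) v = (r v : ℂ)) (hlow : ∀ v, δ * ‖v‖ ^ 2 ≤ r v)
    (hupp : ∀ v, r v ≤ (1 - δ) * ‖v‖ ^ 2) : P x = (r x : ℂ) • x := by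
  have hx1 : ‖x‖ = 1 := norm_eq_one_of_mem hψ.1 hx
  have h0 : 0 < r x := lt_of_lt_of_le hδ (by simpa [hx1] using hlow x)
  have h1 : 0 < 1 - r x := by
    have := hupp x
    rw [hx1] at this
    linarith
  have hQ : ∀ v, inner ℂ (((1 : H →L[ℂ] H) - P) v) v = ((‖v‖ ^ 2 - r v : ℝ) : ℂ) := fun v => by
    rw [sub_apply, one_apply_eq_self, inner_sub_left, hr, inner_self_eq_ofReal]
    push_cast; rfl
  have hψ₁ := smul_coefficient_mem_stateSpace (x := x) hP
    (fun v => by rw [hr]; exact_mod_cast (by positivity : 0 ≤ δ * ‖v‖ ^ 2).trans (hlow v)) h0 (hr x)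
  have hψ₂ := smul_coefficient_mem_stateSpace (x := x) (π := π) (P := 1 - P)
    (fun a v => by simp [hP])
    (fun v => by
      rw [hQ]
      exact_mod_cast (by nlinarith [hupp v, sq_nonneg ‖v‖] : 0 ≤ ‖v‖ ^ 2 - r v)) h1
    (by rw [hQ, hx1]; simp)
  have hmem : ψ ∈ openSegment ℝ ((r x)⁻¹ • coefficient π (P x) x)
      ((1 - r x)⁻¹ • coefficient π (((1 : H →L[ℂ] H) - P) x) x) := by
    refine ⟨r x, 1 - r x, h0, h1, by ring, ?_⟩
    rw [smul_smul, smul_smul, mul_inv_cancel₀ h0.ne', mul_inv_cancel₀ h1.ne', one_smul, one_smul]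
    ext a
    simp only [add_apply, coefficient_apply, sub_apply,
      one_apply_eq_self, inner_sub_left]
    rw [hx a]
    ring
  have heq := hψ.2 hψ₁ hψ₂ hmem
  refine eq_of_inner_cyclic hc fun a => ?_
  have h := congrArg (fun f : A →L[ℂ] ℂ => (r x : ℂ) * f a) heq
  simp only [smul_apply, coefficient_apply, Complex.real_smul] at h
  rw [inner_smul_left, Complex.conj_ofReal, ← hx a, ← h, ← mul_assoc, ← Complex.ofReal_mul,
    mul_inv_cancel₀ h0.ne', Complex.ofReal_one, one_mul]

theorem exists_apply_eq_smul_of_isSelfAdjoint {ψ : A →L[ℂ] ℂ} (hψ : ψ ∈ pureStates A) {x : H}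
    (hx : x ∈ implementingVectors π ψ) (hc : DenseRange (orbitMap π x)) {T : H →L[ℂ] H}
    (hT : ∀ a v, T (π a v) = π a (T v)) (hsa : IsSelfAdjoint T) : ∃ c : ℂ, T x = c • x := by
  -- This scaling puts 1/2 + εT between 1/4 and 3/4.
  set ε : ℝ := (4 * (‖T‖ + 1))⁻¹ with hε
  have hε0 : 0 < ε := by positivity
  have hεT : ε * ‖T‖ ≤ 1 / 4 := by
    rw [hε, inv_mul_le_iff₀ (by positivity)]
    linarith [norm_nonneg T]
  set q : H → ℝ := fun v => (inner ℂ (T v) v : ℂ).re with hq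
  have hqv : ∀ v, inner ℂ (T v) v = (q v : ℂ) := fun v => by
    have h : (starRingEnd ℂ) (inner ℂ (T v) v) = inner ℂ (T v) v := by
      rw [inner_conj_symm]
      exact (hsa.isSymmetric v v).symm
    exact (Complex.conj_eq_iff_re.mp h).symm
  have hqb : ∀ v, |ε * q v| ≤ 1 / 4 * ‖v‖ ^ 2 := fun v => by
    have h1 : |q v| ≤ ‖T‖ * ‖v‖ * ‖v‖ :=
      (Complex.abs_re_le_norm _).trans ((norm_inner_le_norm _ _).trans
        (by gcongr; exact T.le_opNorm v))
    rw [abs_mul, abs_of_pos hε0]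
    calc ε * |q v| ≤ ε * (‖T‖ * ‖v‖ * ‖v‖) := by gcongr
      _ = (ε * ‖T‖) * ‖v‖ ^ 2 := by ring
      _ ≤ _ := by gcongr
  have hkey := apply_eq_smul_of_bounds hψ hx hc
    (P := ((1 / 2 : ℝ) : ℂ) • (1 : H →L[ℂ] H) + (ε : ℂ) • T) (δ := 1 / 4)
    (r := fun v => 1 / 2 * ‖v‖ ^ 2 + ε * q v)
    (fun a v => by simp [hT]) (by norm_num)
    (fun v => by
      simp only [add_apply, smul_apply,
        one_apply_eq_self, inner_add_left, inner_smul_left, Complex.conj_ofReal, hqv,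
        inner_self_eq_ofReal]
      push_cast; rfl)
    (fun v => by linarith [(abs_le.mp (hqb v)).1])
    (fun v => by linarith [(abs_le.mp (hqb v)).2])
  set R : ℝ := 1 / 2 * ‖x‖ ^ 2 + ε * q x
  refine ⟨(ε : ℂ)⁻¹ * ((R : ℂ) - ((1 / 2 : ℝ) : ℂ)), ?_⟩
  simp only [add_apply, smul_apply,
        one_apply_eq_self] at hkey
  rw [mul_smul, sub_smul, ← hkey, add_sub_cancel_left, smul_smul,
    inv_mul_cancel₀ (Complex.ofReal_ne_zero.mpr hε0.ne'), one_smul]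

/-- The GNS representation of a pure state is irreducible. -/
theorem hasTrivialCommutant_of_mem_pureStates {ψ : A →L[ℂ] ℂ} (hψ : ψ ∈ pureStates A) {x : H}
    (hx : x ∈ implementingVectors π ψ) (hc : DenseRange (orbitMap π x)) :
    HasTrivialCommutant π := by
  intro T hT
  have hadj : ∀ a v, T.adjoint (π a v) = π a (T.adjoint v) := by
    intro a v
    refine ext_inner_left ℂ fun w => ?_
    rw [ContinuousLinearMap.adjoint_inner_right, inner_map_right, inner_map_right, ← hT,
      ContinuousLinearMap.adjoint_inner_right]
  -- T is a combination of the self-adjoint operators T + T* and i(T - T*), so x is an eigenvector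
  -- of T too.
  obtain ⟨c, hcx⟩ := exists_apply_eq_smul_of_isSelfAdjoint hψ hx hc (T := T + T.adjoint)
    (fun a v => by simp [hT, hadj])
    (by
      rw [← ContinuousLinearMap.star_eq_adjoint]
      exact IsSelfAdjoint.add_star_self T)
  obtain ⟨d, hdx⟩ := exists_apply_eq_smul_of_isSelfAdjoint hψ hx hc
    (T := Complex.I • (T - T.adjoint)) (fun a v => by simp [hT, hadj])
    (by
      rw [← ContinuousLinearMap.star_eq_adjoint, IsSelfAdjoint, star_smul, star_sub, star_star]
      simp [smul_sub, neg_add_eq_sub])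
  refine ⟨(c - Complex.I * d) / 2, apply_eq_smul_of_apply_cyclic hc hT ?_⟩
  simp only [add_apply, smul_apply,
    sub_apply] at hcx hdx
  have h2 : T x = (1 / 2 : ℂ) • ((T x + T.adjoint x) -
      Complex.I • Complex.I • (T x - T.adjoint x)) := by
    rw [smul_smul, Complex.I_mul_I]
    module
  rw [h2, hcx, hdx]
  module

theorem norm_coefficient_map_le {ψ : A →L[ℂ] ℂ} {K : Type u} [NormedAddCommGroup K]
    [InnerProductSpace ℂ K] [CompleteSpace K] {ρ : A →⋆ₐ[ℂ] (K →L[ℂ] K)} {y : H} {z : K}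
    (hz : z ∈ implementingVectors ρ ψ) {C : ℝ} (hC : 0 ≤ C)
    (h : ∀ a, ψ (star a * a) ≤ C * coefficient π y y (star a * a)) (a : A) :
    ‖ρ a z‖ ≤ √C * ‖π a y‖ := by
  have h1 := h a
  rw [← norm_sq_map_eq hz, ← norm_sq_map_eq (mem_implementingVectors_coefficient π y)] at h1
  have h2 : ‖ρ a z‖ ^ 2 ≤ C * ‖π a y‖ ^ 2 := by exact_mod_cast h1
  refine le_of_sq_le_sq ?_ (by positivity)
  rwa [mul_pow, Real.sq_sqrt hC]

/-- The vector states of an irreducible representation are pure. -/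
theorem HasTrivialCommutant.coefficient_mem_pureStates (hπ : HasTrivialCommutant π) {y : H}
    (hy : ‖y‖ = 1) : coefficient π y y ∈ pureStates A := by
  have hy0 : y ≠ 0 := by
    rintro rfl
    simp at hy
  refine ⟨coefficient_self_mem_stateSpace π hy, ?_⟩
  rintro ψ₁ hψ₁ ψ₂ hψ₂ ⟨s, t, hs, ht, -, hst⟩
  -- Since ψ₁ is at most s⁻¹ times the vector state, its GNS vector is Wy for an intertwiner W. Then
  -- W*W is a scalar, which normalisation forces to be 1.
  obtain ⟨K, _, _, _, ρ, z, hz, -⟩ := exists_cyclic_representation hψ₁.1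
  have hdom : ∀ a, ψ₁ (star a * a) ≤ (s⁻¹ : ℝ) * coefficient π y y (star a * a) := by
    intro a
    rw [← hst, add_apply, smul_apply,
      smul_apply, Complex.real_smul, Complex.real_smul, mul_add, ← mul_assoc,
      ← Complex.ofReal_mul, inv_mul_cancel₀ hs.ne', Complex.ofReal_one, one_mul]
    refine le_add_of_nonneg_right (mul_nonneg ?_ (mul_nonneg ?_ (hψ₂.1 a)))
    · exact_mod_cast (inv_pos.mpr hs).le
    · exact_mod_cast ht.le
  obtain ⟨W, -, hWy, hW⟩ := exists_intertwiner (hπ.denseRange_orbitMap hy0)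
    (Real.sqrt_nonneg _) (norm_coefficient_map_le hz (by positivity) hdom)
  obtain ⟨c, hc⟩ := hπ (W.adjoint ∘L W) (fun a v => adjoint_comp_intertwines hW hW a v)
  have hψc : ∀ a, ψ₁ a = c * coefficient π y y a := by
    intro a
    rw [hz a, ← hWy, ← hW, ← ContinuousLinearMap.adjoint_inner_right]
    have := hc (π a y)
    rw [ContinuousLinearMap.comp_apply] at this
    rw [this, inner_smul_right, coefficient_apply]
  have hc1 : c = 1 := by
    have h := hψc 1
    rw [hψ₁.2, (coefficient_self_mem_stateSpace π hy).2, mul_one] at h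
    exact h.symm
  ext a
  rw [hψc, hc1, one_mul]

/-- The bound does not depend on ρ, so the supremum over all representations is already attained in
π. -/
theorem HasTrivialCommutant.norm_inner_le (hπ : HasTrivialCommutant π) {x y : H}
    (hx : ‖x‖ = 1) (hy : ‖y‖ = 1) {K : Type u} [NormedAddCommGroup K]
    [InnerProductSpace ℂ K] [CompleteSpace K] {ρ : A →⋆ₐ[ℂ] (K →L[ℂ] K)} {x' y' : K}
    (hx' : x' ∈ implementingVectors ρ (coefficient π x x))
    (hy' : y' ∈ implementingVectors ρ (coefficient π y y)) :
    ‖inner ℂ x' y'‖ ≤ ‖inner ℂ x y‖ := by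
  have hne : ∀ v : H, ‖v‖ = 1 → v ≠ 0 := by
    rintro v hv rfl
    simp at hv
  obtain ⟨U, hUn, hUx, hU⟩ := exists_intertwiner (hπ.denseRange_orbitMap (hne x hx))
    (Real.sqrt_nonneg 1) (norm_coefficient_map_le hx' zero_le_one fun a => by simp)
  obtain ⟨V, hVn, hVy, hV⟩ := exists_intertwiner (hπ.denseRange_orbitMap (hne y hy))
    (Real.sqrt_nonneg 1) (norm_coefficient_map_le hy' zero_le_one fun a => by simp)
  rw [Real.sqrt_one] at hUn hVn
  obtain ⟨c, hc⟩ := hπ (U.adjoint ∘L V) (fun a v => adjoint_comp_intertwines hU hV a v)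
  have hc1 : ‖c‖ ≤ 1 := by
    have h : ‖c • x‖ ≤ ‖U.adjoint‖ * (‖V‖ * ‖x‖) := by
      rw [← hc x]
      exact (U.adjoint.le_opNorm _).trans (by gcongr; exact V.le_opNorm x)
    rw [norm_smul, hx, mul_one, mul_one, LinearIsometryEquiv.norm_map] at h
    nlinarith [norm_nonneg U, norm_nonneg V]
  have hin : inner ℂ x' y' = c * inner ℂ x y := by
    rw [← hUx, ← hVy, ← ContinuousLinearMap.adjoint_inner_right, ← inner_smul_right, ← hc y,
      ContinuousLinearMap.comp_apply]
  rw [hin, norm_mul]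
  exact mul_le_of_le_one_left (norm_nonneg _) hc1

/-- The fidelity of two vector states of an irreducible representation. -/
theorem HasTrivialCommutant.fidelity_eq (hπ : HasTrivialCommutant π) {x y : H}
    (hx : ‖x‖ = 1) (hy : ‖y‖ = 1) :
    fidelity (coefficient π x x) (coefficient π y y) = ‖inner ℂ x y‖ := by
  have hSx := coefficient_self_mem_stateSpace π hx
  have hSy := coefficient_self_mem_stateSpace π hy
  refine le_antisymm (Real.sSup_le ?_ (norm_nonneg _)) ?_
  · rintro _ ⟨K, _, _, _, ρ, rfl⟩
    refine Real.sSup_le ?_ (norm_nonneg _)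
    rintro _ ⟨x', hx', y', hy', rfl⟩
    exact hπ.norm_inner_le hx hy hx' hy'
  · refine le_trans (le_csSup (bddAbove_overlaps hSx hSy)
      ⟨x, mem_implementingVectors_coefficient π x, y, mem_implementingVectors_coefficient π y,
        rfl⟩) ?_
    exact le_csSup (bddAbove_repFidelities hSx hSy) ⟨H, _, _, _, π, rfl⟩

end Representation

/-! ### Separation by positive functionals, states and pure states -/

section Separation

attribute [local instance] CStarAlgebra.spectralOrder CStarAlgebra.spectralOrderedRing

/-- The functional `a ↦ g a + conj (g a*)`, twice the hermitian part of `g`. -/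
noncomputable def hermitianSum (g : A →L[ℂ] ℂ) : A →L[ℂ] ℂ :=
  LinearMap.mkContinuous
    { toFun := fun a => g a + (starRingEnd ℂ) (g (star a))
      map_add' := fun a b => by simp only [star_add, map_add]; ring
      map_smul' := fun c a => by simp [mul_add] }
    (‖g‖ + ‖g‖) fun a => by
      calc ‖g a + (starRingEnd ℂ) (g (star a))‖ ≤ ‖g a‖ + ‖(starRingEnd ℂ) (g (star a))‖ :=
            norm_add_le _ _
        _ ≤ ‖g‖ * ‖a‖ + ‖g‖ * ‖a‖ := by
            rw [RCLike.norm_conj]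
            refine add_le_add (g.le_opNorm a) ?_
            simpa using g.le_opNorm (star a)
        _ = _ := by ring

theorem hermitianSum_apply_of_isSelfAdjoint (g : A →L[ℂ] ℂ) {a : A} (ha : IsSelfAdjoint a) :
    hermitianSum g a = ((2 * (g a).re : ℝ) : ℂ) := by
  change g a + (starRingEnd ℂ) (g (star a)) = _
  rw [ha.star_eq, Complex.add_conj]

/-- Positive functionals separate nonzero elements from zero. -/
theorem exists_positive_apply_star_mul_self_ne_zero {c : A} (hc : c ≠ 0) :
    ∃ ψ : A →L[ℂ] ℂ, (∀ a, 0 ≤ ψ (star a * a)) ∧ ψ (star c * c) ≠ 0 := by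
  have hnot : -(star c * c) ∉ {a : A | 0 ≤ a} := by
    intro h
    have h0 : star c * c = 0 := le_antisymm (neg_nonneg.mp h) (star_mul_self_nonneg c)
    exact hc (CStarRing.star_mul_self_eq_zero_iff c |>.mp h0)
  have hconv : Convex ℝ {a : A | 0 ≤ a} := by
    intro a ha b hb s t hs ht _
    simp only [Set.mem_ofPred_eq] at ha hb ⊢
    exact add_nonneg (smul_nonneg hs ha) (smul_nonneg ht hb)
  obtain ⟨g, u, hu, hg⟩ := RCLike.geometric_hahn_banach_point_closed (𝕜 := ℂ) hconv
    (CStarAlgebra.isClosed_nonneg (A := A)) hnot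
  have hu0 : u < 0 := by simpa using hg 0 (le_refl (0 : A))
  have hpos : ∀ a : A, 0 ≤ a → 0 ≤ (g a).re := by
    intro a ha
    by_contra! hneg
    -- Rescaling within the cone makes the real part equal to u, against the strict bound.
    have h := hg ((u / (g a).re) • a) (smul_nonneg (div_nonneg_of_nonpos hu0.le hneg.le) ha)
    rw [← Complex.coe_smul, map_smul, smul_eq_mul, RCLike.re_eq_complex_re, Complex.re_ofReal_mul,
      div_mul_cancel₀ _ hneg.ne] at h
    exact lt_irrefl _ h
  refine ⟨hermitianSum g, fun a => ?_, ?_⟩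
  · rw [hermitianSum_apply_of_isSelfAdjoint g (IsSelfAdjoint.star_mul_self a)]
    exact_mod_cast mul_nonneg zero_le_two (hpos _ (star_mul_self_nonneg a))
  · rw [hermitianSum_apply_of_isSelfAdjoint g (IsSelfAdjoint.star_mul_self c)]
    rw [map_neg, map_neg, RCLike.re_eq_complex_re] at hu
    exact Complex.ofReal_ne_zero.mpr (by linarith)

end Separation

theorem exists_mem_stateSpace_apply_star_mul_self_ne_zero {c : A} (hc : c ≠ 0) :
    ∃ ψ ∈ stateSpace A, ψ (star c * c) ≠ 0 := by
  obtain ⟨φ, hφ, hφc⟩ := exists_positive_apply_star_mul_self_ne_zero hc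
  obtain ⟨H, _, _, _, π, x, hx, -⟩ := exists_cyclic_representation hφ
  have hx0 : x ≠ 0 := by
    rintro rfl
    exact hφc (by rw [hx, inner_zero_left])
  have hn : ‖x‖ ≠ 0 := norm_ne_zero_iff.mpr hx0
  refine ⟨coefficient π (((‖x‖⁻¹ : ℝ) : ℂ) • x) (((‖x‖⁻¹ : ℝ) : ℂ) • x),
    coefficient_self_mem_stateSpace π (by simp [norm_smul, hn]), ?_⟩
  rw [coefficient_apply, map_smul, inner_smul_left, inner_smul_right, ← hx]
  simpa [hx0] using hφc

/-- This places the states in the unit ball, so that Banach-Alaoglu applies. -/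
theorem norm_le_one_of_mem_stateSpace {ψ : A →L[ℂ] ℂ} (hψ : ψ ∈ stateSpace A) : ‖ψ‖ ≤ 1 := by
  obtain ⟨H, _, _, _, π, x, hx, -⟩ := exists_cyclic_representation hψ.1
  have hx1 := norm_eq_one_of_mem hψ hx
  refine ψ.opNorm_le_bound zero_le_one fun a => ?_
  calc ‖ψ a‖ = ‖inner ℂ x (π a x)‖ := by rw [hx]
    _ ≤ ‖x‖ * (‖π a‖ * ‖x‖) :=
        (norm_inner_le_norm x _).trans (by gcongr; exact (π a).le_opNorm x)
    _ ≤ 1 * ‖a‖ := by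
        rw [hx1, one_mul, one_mul, mul_one]
        exact NonUnitalStarAlgHom.norm_apply_le π a

theorem convex_stateSpace : Convex ℝ (stateSpace A) := by
  intro ψ hψ φ hφ s t hs ht hst
  refine ⟨fun a => ?_, ?_⟩
  · rw [add_apply, smul_apply, smul_apply]
    exact add_nonneg (smul_nonneg hs (hψ.1 a)) (smul_nonneg ht (hφ.1 a))
  · rw [add_apply, smul_apply, smul_apply, hψ.2, hφ.2, ← add_smul, hst, one_smul]

theorem isCompact_stateSpace :
    IsCompact (WeakDual.toStrongDual ⁻¹' stateSpace A : Set (WeakDual ℂ A)) := by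
  refine (WeakDual.isCompact_closedBall (0 : StrongDual ℂ A) 1).of_isClosed_subset ?_ ?_
  · have h : (WeakDual.toStrongDual ⁻¹' stateSpace A : Set (WeakDual ℂ A)) =
        (⋂ a : A, {ψ | 0 ≤ ψ (star a * a)}) ∩ {ψ | ψ 1 = 1} := by
      ext ψ
      simp [stateSpace]
    rw [h]
    refine IsClosed.inter (isClosed_iInter fun a => ?_) ?_
    · exact isClosed_le continuous_const (WeakDual.eval_continuous _)
    · exact isClosed_eq (WeakDual.eval_continuous _) continuous_const
  · intro ψ hψ
    rw [Set.mem_preimage, mem_closedBall_zero_iff]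
    exact norm_le_one_of_mem_stateSpace hψ

/-- Pure states separate nonzero elements from zero, by the Krein-Milman theorem. -/
theorem exists_mem_pureStates_apply_star_mul_self_ne_zero {c : A} (hc : c ≠ 0) :
    ∃ ψ ∈ pureStates A, ψ (star c * c) ≠ 0 := by
  by_contra! hall
  obtain ⟨φ, hφ, hφc⟩ := exists_mem_stateSpace_apply_star_mul_self_ne_zero hc
  set S : Set (WeakDual ℂ A) := WeakDual.toStrongDual ⁻¹' stateSpace A with hS
  have hSconv : Convex ℝ S := fun ψ hψ θ hθ s t hs ht hst => convex_stateSpace hψ hθ hs ht hst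
  have : LocallyConvexSpace ℝ (WeakDual ℂ A) :=
    inferInstanceAs (LocallyConvexSpace ℝ (WeakBilin (topDualPairing ℂ A)))
  have : ContinuousSMul ℝ (WeakDual ℂ A) := WeakDual.instContinuousSMul ℝ
  have hKM := closure_convexHull_extremePoints (s := S) isCompact_stateSpace hSconv
  -- Vanishing at c*c is a convex, weak-* closed condition, so it would pass from pure states to all
  -- states.
  have hsub : closure (convexHull ℝ (S.extremePoints ℝ)) ⊆ {ψ | ψ (star c * c) = 0} := by
    refine closure_minimal (convexHull_min ?_ ?_)
      (isClosed_eq (WeakDual.eval_continuous _) continuous_const)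
    · intro ψ hψ
      exact hall (WeakDual.toStrongDual ψ) hψ
    · intro ψ hψ θ hθ s t _ _ _
      change s • ψ (star c * c) + t • θ (star c * c) = 0
      rw [Set.mem_ofPred_eq.mp hψ, Set.mem_ofPred_eq.mp hθ, smul_zero, smul_zero, add_zero]
  rw [hKM] at hsub
  exact hφc (hsub (show StrongDual.toWeakDual φ ∈ S from hφ))

/-! ### Commutative algebras -/

section Commutative

/-- Each π a lies in the commutant of the irreducible GNS representation, hence is a scalar. -/
theorem map_mul_of_mem_pureStates (hA : ∀ a b : A, a * b = b * a) {ψ : A →L[ℂ] ℂ}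
    (hψ : ψ ∈ pureStates A) (a b : A) : ψ (a * b) = ψ a * ψ b := by
  obtain ⟨H, _, _, _, π, x, hx, hc⟩ := exists_cyclic_representation hψ.1.1
  have hπ := hasTrivialCommutant_of_mem_pureStates hψ hx hc
  obtain ⟨s, hs⟩ := hπ (π a) fun b v => by
    rw [← map_mul_apply_eq, hA, map_mul_apply_eq]
  have hx1 : inner ℂ x x = (1 : ℂ) := by
    rw [inner_self_eq_ofReal, norm_eq_one_of_mem hψ.1 hx]
    simp
  rw [hx (a * b), hx a, hx b, map_mul_apply_eq, hs, hs, inner_smul_right, inner_smul_right, hx1,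
    mul_one]

variable {K : Type u} [NormedAddCommGroup K] [InnerProductSpace ℂ K] [CompleteSpace K]
  {ρ : A →⋆ₐ[ℂ] (K →L[ℂ] K)}

/-- A vector implementing a multiplicative state is a joint eigenvector. -/
theorem map_apply_eq_smul {ψ : A →L[ℂ] ℂ} (h1 : ψ 1 = 1) (hmul : ∀ a b, ψ (a * b) = ψ a * ψ b)
    {x : K} (hx : x ∈ implementingVectors ρ ψ) (a : A) : ρ a x = ψ a • x := by
  -- By multiplicativity, ψ(b*b) = 0 for b = a - ψ(a)1.
  have h := norm_sq_map_eq hx (a - ψ a • 1)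
  rw [hmul, map_sub ψ, map_smul ψ, h1, smul_eq_mul, mul_one, sub_self, mul_zero] at h
  have h2 : ρ (a - ψ a • 1) x = 0 := by
    have h3 : ‖ρ (a - ψ a • 1) x‖ ^ 2 = 0 := by exact_mod_cast h
    exact norm_eq_zero.mp (pow_eq_zero_iff two_ne_zero |>.mp h3)
  rw [map_sub, map_smul, map_one, sub_apply, smul_apply, one_apply_eq_self] at h2
  exact sub_eq_zero.mp h2

/-- Evaluating ⟨x, ρ(a)y⟩ = ⟨ρ(a*)x, y⟩ with the eigenvalues on both sides gives φ(a)⟨x, y⟩ =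
ψ(a)⟨x, y⟩. -/
theorem eq_of_inner_ne_zero (hA : ∀ a b : A, a * b = b * a) {ψ φ : A →L[ℂ] ℂ}
    (hψ : ψ ∈ pureStates A) (hφ : φ ∈ pureStates A) {x y : K} (hx : x ∈ implementingVectors ρ ψ)
    (hy : y ∈ implementingVectors ρ φ) (hxy : inner ℂ x y ≠ 0) : ψ = φ := by
  ext a
  have hy' := map_apply_eq_smul hφ.1.2 (map_mul_of_mem_pureStates hA hφ) hy a
  have hx' := map_apply_eq_smul hψ.1.2 (map_mul_of_mem_pureStates hA hψ) hx (star a)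
  have hstar : (starRingEnd ℂ) (ψ (star a)) = ψ a := by
    rw [hx, hx, inner_conj_symm, ← inner_map_right]
  have h := inner_map_right ρ a x y
  rw [hy', hx', inner_smul_left, inner_smul_right, hstar] at h
  exact (mul_right_cancel₀ hxy h).symm

theorem one_le_fidelity_self {ψ : A →L[ℂ] ℂ} (hψ : ψ ∈ stateSpace A) : 1 ≤ fidelity ψ ψ := by
  obtain ⟨H, _, _, _, π, x, hx, -⟩ := exists_cyclic_representation hψ.1
  have h1 : (1 : ℝ) ∈ overlaps π ψ ψ := ⟨x, hx, x, hx, by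
    rw [inner_self_eq_ofReal, norm_eq_one_of_mem hψ hx]
    simp⟩
  exact (le_csSup (bddAbove_overlaps hψ hψ) h1).trans
    (le_csSup (bddAbove_repFidelities hψ hψ) ⟨H, _, _, _, π, rfl⟩)

theorem fidelity_nonpos_of_ne (hA : ∀ a b : A, a * b = b * a) {ψ φ : A →L[ℂ] ℂ}
    (hψ : ψ ∈ pureStates A) (hφ : φ ∈ pureStates A) (hne : ψ ≠ φ) : fidelity ψ φ ≤ 0 := by
  refine Real.sSup_le ?_ le_rfl
  rintro _ ⟨K, _, _, _, ρ, rfl⟩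
  refine Real.sSup_le ?_ le_rfl
  rintro _ ⟨x, hx, y, hy, rfl⟩
  by_contra! h
  exact hne (eq_of_inner_ne_zero hA hψ hφ hx hy (norm_pos_iff.mp h))

end Commutative

/-! ### Noncommutative algebras -/

/-- A noncommutative C*-algebra has an irreducible representation of dimension at least two. -/
theorem exists_irreducible_orthonormal {a b : A} (hab : a * b ≠ b * a) :
    ∃ (H : Type u) (_ : NormedAddCommGroup H) (_ : InnerProductSpace ℂ H) (_ : CompleteSpace H)
      (π : A →⋆ₐ[ℂ] (H →L[ℂ] H)) (x w : H), HasTrivialCommutant π ∧ ‖x‖ = 1 ∧ ‖w‖ = 1 ∧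
        inner ℂ x w = (0 : ℂ) := by
  obtain ⟨ψ, hψ, hne⟩ := exists_mem_pureStates_apply_star_mul_self_ne_zero (sub_ne_zero.mpr hab)
  obtain ⟨H, _, _, _, π, x, hx, hc⟩ := exists_cyclic_representation hψ.1.1
  have hπ := hasTrivialCommutant_of_mem_pureStates hψ hx hc
  have hx1 := norm_eq_one_of_mem hψ.1 hx
  -- If x spanned H, the commutator would kill x, contradicting the choice of ψ.
  have hex : ∃ v : H, v - (inner ℂ x v : ℂ) • x ≠ 0 := by
    by_contra! hall
    have hv : ∀ v : H, v = (inner ℂ x v : ℂ) • x := fun v => sub_eq_zero.mp (hall v)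
    have hact : ∀ d : A, π d x = ψ d • x := fun d => by rw [hx d, ← hv]
    have hzero : π (a * b - b * a) x = 0 := by
      rw [map_sub, sub_apply, map_mul_apply_eq, map_mul_apply_eq, hact b, hact a, map_smul,
        map_smul, hact a, hact b, smul_smul, smul_smul, mul_comm, sub_self]
    refine hne ?_
    rw [← norm_sq_map_eq hx, hzero]
    simp
  obtain ⟨v, hv⟩ := hex
  have hn : ‖v - (inner ℂ x v : ℂ) • x‖ ≠ 0 := norm_ne_zero_iff.mpr hv
  refine ⟨H, _, _, _, π, x, ((‖v - (inner ℂ x v : ℂ) • x‖⁻¹ : ℝ) : ℂ) •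
    (v - (inner ℂ x v : ℂ) • x), hπ, hx1, ?_, ?_⟩
  · rw [norm_smul, Complex.norm_real, norm_inv, norm_norm, inv_mul_cancel₀ hn]
  · rw [inner_smul_right, inner_sub_right, inner_smul_right, inner_self_eq_ofReal, hx1]
    simp

theorem exists_pureStates_fidelity_eq {a b : A} (hab : a * b ≠ b * a) {α : ℝ} (h0 : 0 ≤ α)
    (h1 : α ≤ 1) : ∃ ψ ∈ pureStates A, ∃ φ ∈ pureStates A, fidelity ψ φ = α := by
  obtain ⟨H, _, _, _, π, x, w, hπ, hx, hw, hxw⟩ := exists_irreducible_orthonormal hab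
  have hα : 0 ≤ 1 - α ^ 2 := by nlinarith
  have hwx : inner ℂ w x = (0 : ℂ) := inner_eq_zero_symm.mp hxw
  -- Rotating x towards w gives a unit vector whose overlap with x is α.
  have hy : ‖(α : ℂ) • x + ((√(1 - α ^ 2) : ℝ) : ℂ) • w‖ = 1 := by
    have h : ‖(α : ℂ) • x + ((√(1 - α ^ 2) : ℝ) : ℂ) • w‖ * ‖(α : ℂ) • x +
        ((√(1 - α ^ 2) : ℝ) : ℂ) • w‖ = 1 := by
      rw [norm_add_sq_eq_norm_sq_add_norm_sq_of_inner_eq_zero (𝕜 := ℂ) _ _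
        (by rw [inner_smul_left, inner_smul_right, hxw, mul_zero, mul_zero]),
        norm_smul, norm_smul, hx, hw, mul_one, mul_one, Complex.norm_real, Complex.norm_real,
        Real.norm_eq_abs, Real.norm_eq_abs, abs_mul_abs_self, abs_mul_abs_self,
        Real.mul_self_sqrt hα]
      ring
    nlinarith [norm_nonneg ((α : ℂ) • x + ((√(1 - α ^ 2) : ℝ) : ℂ) • w)]
  refine ⟨_, hπ.coefficient_mem_pureStates hx, _, hπ.coefficient_mem_pureStates hy, ?_⟩
  rw [hπ.fidelity_eq hx hy, inner_add_right, inner_smul_right, inner_smul_right, hxw,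
    inner_self_eq_ofReal, hx]
  simp [abs_of_nonneg h0]

end CStarFidelity

theorem proposition4 (A : Type u) [CStarAlgebra A] :
    List.TFAE [
      ¬ ∀ a b : A, a * b = b * a,
      ∃ ψ ∈ CStarFidelity.pureStates A, ∃ φ ∈ CStarFidelity.pureStates A,
        0 < CStarFidelity.fidelity ψ φ ∧ CStarFidelity.fidelity ψ φ < 1,
      ∀ α : ℝ, 0 ≤ α → α ≤ 1 →
        ∃ ψ ∈ CStarFidelity.pureStates A, ∃ φ ∈ CStarFidelity.pureStates A,
          CStarFidelity.fidelity ψ φ = α] := by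
  tfae_have 1 → 3 := by
    intro h α h0 h1
    push Not at h
    obtain ⟨a, b, hab⟩ := h
    exact CStarFidelity.exists_pureStates_fidelity_eq hab h0 h1
  tfae_have 3 → 2 := by
    intro h
    obtain ⟨ψ, hψ, φ, hφ, hF⟩ := h (1 / 2) (by norm_num) (by norm_num)
    exact ⟨ψ, hψ, φ, hφ, by rw [hF]; norm_num, by rw [hF]; norm_num⟩
  tfae_have 2 → 1 := by
    rintro ⟨ψ, hψ, φ, hφ, hpos, hlt⟩ hA
    by_cases hne : ψ = φ
    · subst hne
      exact absurd (CStarFidelity.one_le_fidelity_self hψ.1) (not_le.mpr hlt)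
    · exact absurd (CStarFidelity.fidelity_nonpos_of_ne hA hψ hφ hne) (not_le.mpr hpos)
  tfae_finish
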